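/- Let $n\ge 1$ and $[n]=\{1,\dots,n\}$. Let $h:[n]\to[n]$ be a Hessenberg function, i.e. $h$ is weakly increasing and $h(i)\ge i$ for all $i$, and let $w\in\mathfrak S_n$. Let $G_{w,h}$ be the directed graph on $[n]$ with an edge $j\to i$ if and only if $j<i\le h(j)$ and $w(j)<w(i)$. A vertex $i$ is reachable from $j$ if there is a directed path, possibly of length $0$, from $j$ to $i$. For subsets $A=\{a_1<\dots<a_k\}$ and $B=\{b_1<\dots<b_k\}$ of $[n]$, $A$ is reachable from $B$ if there is $\sigma\in\mathfrak S_k$ such that $a_{\sigma(d)}$ is reachable from $b_d$ for all $d=1,\dots,k$. Let $\mathcal B\subset GL_n(\mathbb C)$ be the subgroup of upper triangular matrices, and identify $g\mathcal B\in GL_n(\mathbb C)/\mathcal B$ with the flag $V_1\subset\dots\subset V_n=\mathbb C^n$ in which $V_i$ is spanned by the first $i$ columns of $g$. For distinct $c_1,\dots,c_n\in\mathbb C$ let $S=\operatorname{diag}(c_1,\dots,c_n)$ and $$\mathrm{Hess}(S,h)=\{V_\bullet \mid S V_i\subseteq V_{h(i)}\text{ for all } i\}.$$ For integers $\lambda_1>\dots>\lambda_n$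 let $\lambda(t)=\operatorname{diag}(t^{\lambda_1},\dots,t^{\lambda_n})$, let $\dot w$ be the permutation matrix with $1$ in the entries $(w(i),i)$, and let $$\Omega^\circ_{w,h}=\{g\mathcal B\in \mathrm{Hess}(S,h)\mid \lim_{t\to\infty}\lambda(t)g\mathcal B=\dot w\mathcal B\}$$ be the minus cell. **Theorem.** Let $h$ and $w$ be as above, and let $A,B\subseteq[n]$ be subsets with $|A|=|B|=k$. Then there exist distinct complex numbers $c_1,\dots,c_n$ such that, for $S=\operatorname{diag}(c_1,\dots,c_n)$ and every choice of integers $\lambda_1>\dots>\lambda_n$, the following holds. The lower triangular matrices $x=(x_{i,j})$ having $1$ on the diagonal and satisfying $\dot w x\mathcal B\in\Omega^\circ_{w,h}$ are parametrized by the free variables $x_{i,j}$ with $(j\to i)\in G_{w,h}$: there is a unique matrix $X$ of polynomials over $\mathbb C$ in these variables whose $(i,j)$ entry is the variable $x_{i,j}$ for each edge $j\to i$ and whose specializations at all complex values of the variables are exactly these matrices $x$. The minor $$p_{A,B}(x)=\det(x_{a,b})_{a\in A,\,b\in B},$$ viewed in this way as a polynomial in the free variables, is not identically zero if and only if $A$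 is reachable from $B$ in $G_{w,h}$. -/

import Mathlib

noncomputable section

namespace HessCell

open Filter Topology Matrix

/-! Indices `1, …, n` are represented by `Fin n`; the order is the same, so nothing but the
names of the indices is shifted. -/

/-- Hessenberg functions: weakly increasing with `i ≤ h i`. -/
def IsHessenberg {n : ℕ} (h : Fin n → Fin n) : Prop :=
  Monotone h ∧ ∀ i, i ≤ h i

/-! ### The graph and reachability -/

/-- There is an edge `j → i` in the directed graph of `(w, h)`. -/
def Edge {n : ℕ} (w : Equiv.Perm (Fin n)) (h : Fin n → Fin n) (j i : Fin n) : Prop :=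
  j < i ∧ i ≤ h j ∧ w j < w i

/-- `i` is reachable from `j`: there is a directed path, possibly of length zero,
from `j` to `i`. -/
def Reachable {n : ℕ} (w : Equiv.Perm (Fin n)) (h : Fin n → Fin n) (j i : Fin n) : Prop :=
  Relation.ReflTransGen (Edge w h) j i

/-- The `k`-element set `A = {a_1 < ⋯ < a_k}` is reachable from `B = {b_1 < ⋯ < b_k}`. -/
def SetReachable {n k : ℕ} (w : Equiv.Perm (Fin n)) (h : Fin n → Fin n)
    (A B : Finset (Fin n)) (hA : A.card = k) (hB : B.card = k) : Prop :=
  ∃ σ : Equiv.Perm (Fin k), ∀ d : Fin k,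
    Reachable w h (B.orderEmbOfFin hB d) (A.orderEmbOfFin hA (σ d))

/-- The `k × k` minor with row indices `A` and column indices `B`, in increasing order. -/
def minor {n k : ℕ} {R : Type*} [CommRing R]
    (A B : Finset (Fin n)) (hA : A.card = k) (hB : B.card = k)
    (x : Matrix (Fin n) (Fin n) R) : R :=
  (x.submatrix (A.orderEmbOfFin hA) (B.orderEmbOfFin hB)).det

/-! ### The flag variety -/

/-- The subgroup of upper triangular matrices in `GL_n(ℂ)`. -/
def borel (n : ℕ) : Subgroup (GL (Fin n) ℂ) where
  carrier := {g | (g : Matrix (Fin n) (Fin n) ℂ).BlockTriangular id}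
  one_mem' := by
    simpa using Matrix.blockTriangular_one (R := ℂ) (b := (id : Fin n → Fin n))
  mul_mem' := by
    intro a b ha hb
    simpa using Matrix.BlockTriangular.mul ha hb
  inv_mem' := by
    intro g hg
    have : Invertible (g : Matrix (Fin n) (Fin n) ℂ) := g.invertible
    have := Matrix.blockTriangular_inv_of_blockTriangular (M := (g : Matrix (Fin n) (Fin n) ℂ)) hg
    simpa [Matrix.coe_units_inv] using this

/-- The flag variety `G/B`, with the quotient of the usual topology of `GL_n(ℂ)`. -/
abbrev FlagVariety (n : ℕ) : Type := GL (Fin n) ℂ ⧸ borel n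

/-- The span of the columns of `g` with index at most `i`. -/
def colSpan {n : ℕ} (g : GL (Fin n) ℂ) (i : Fin n) : Submodule ℂ (Fin n → ℂ) :=
  Submodule.span ℂ ((fun j => (g : Matrix (Fin n) (Fin n) ℂ).col j) '' Set.Iic i)

theorem colSpan_mul_le {n : ℕ} (g b : GL (Fin n) ℂ) (hb : b ∈ borel n) (i : Fin n) :
    colSpan (g * b) i ≤ colSpan g i := by
  refine Submodule.span_le.2 ?_
  rintro _ ⟨j, hj, rfl⟩
  have hcol : ((g * b : GL (Fin n) ℂ) : Matrix (Fin n) (Fin n) ℂ).col j =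
      ∑ k, (b : Matrix (Fin n) (Fin n) ℂ) k j • (g : Matrix (Fin n) (Fin n) ℂ).col k := by
    ext r
    simp [Matrix.mul_apply, mul_comm]
  simp only [SetLike.mem_coe]
  rw [hcol]
  refine Submodule.sum_mem _ fun k _ => ?_
  by_cases hk : k ≤ j
  · exact Submodule.smul_mem _ _ (Submodule.subset_span ⟨k, le_trans hk hj, rfl⟩)
  · have h0 : (b : Matrix (Fin n) (Fin n) ℂ) k j = 0 := hb (not_le.1 hk)
    rw [h0, zero_smul]
    exact Submodule.zero_mem _

theorem colSpan_mul {n : ℕ} (g b : GL (Fin n) ℂ) (hb : b ∈ borel n) (i : Fin n) :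
    colSpan (g * b) i = colSpan g i := by
  refine le_antisymm (colSpan_mul_le g b hb i) ?_
  have := colSpan_mul_le (g * b) b⁻¹ ((borel n).inv_mem hb) i
  simpa using this

/-- The subspace `V_i` of the flag `gB`: the span of the first `i` columns of `g`. -/
def flagStep {n : ℕ} (p : FlagVariety n) (i : Fin n) : Submodule ℂ (Fin n → ℂ) :=
  Quotient.liftOn' p (fun g => colSpan g i) (by
    intro g g' hgg'
    have hb : g⁻¹ * g' ∈ borel n := QuotientGroup.leftRel_apply.1 hgg'
    have := colSpan_mul g (g⁻¹ * g') hb i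
    simpa using this.symm)

@[simp] theorem flagStep_mk {n : ℕ} (g : GL (Fin n) ℂ) (i : Fin n) :
    flagStep (g : FlagVariety n) i = colSpan g i := rfl

/-- The Hessenberg variety of the operator `S = diag(c_1, …, c_n)`:
flags with `S V_i ⊆ V_{h(i)}` for all `i`. -/
def hess {n : ℕ} (c : Fin n → ℂ) (h : Fin n → Fin n) : Set (FlagVariety n) :=
  {p | ∀ i, (flagStep p i).map (Matrix.toLin' (Matrix.diagonal c)) ≤ flagStep p (h i)}

/-! ### Minus cells -/

/-- The permutation matrix `ẇ`, with `1` in the entries `(w(j), j)`. -/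
def permGL {n : ℕ} (w : Equiv.Perm (Fin n)) : GL (Fin n) ℂ where
  val := Matrix.of fun i j => if i = w j then 1 else 0
  inv := Matrix.of fun i j => if j = w i then 1 else 0
  val_inv := by
    ext i j
    rw [Matrix.mul_apply, Fintype.sum_equiv w _
      (fun k => (if i = k then (1 : ℂ) else 0) * if j = k then 1 else 0) (by simp)]
    simp [Matrix.one_apply, eq_comm]
  inv_val := by
    ext i j
    simp [Matrix.mul_apply, Matrix.one_apply, eq_comm]

/-- The one-parameter subgroup `t ↦ diag(t^{λ_1}, …, t^{λ_n})`. -/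
def oneParam {n : ℕ} (lam : Fin n → ℤ) (t : ℂˣ) : GL (Fin n) ℂ where
  val := Matrix.diagonal fun i => ((t ^ lam i : ℂˣ) : ℂ)
  inv := Matrix.diagonal fun i => (((t ^ lam i)⁻¹ : ℂˣ) : ℂ)
  val_inv := by
    rw [Matrix.diagonal_mul_diagonal]
    simp only [Units.mul_inv, Matrix.diagonal_one]
  inv_val := by
    rw [Matrix.diagonal_mul_diagonal]
    simp only [Units.inv_mul, Matrix.diagonal_one]

/-- The minus cell: points `gB` of the Hessenberg variety with
`lim_{t → ∞} λ(t) g B = ẇ B`, where `t` runs over the nonzero complex numbers. -/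
def minusCell {n : ℕ} (lam : Fin n → ℤ) (c : Fin n → ℂ) (h : Fin n → Fin n)
    (w : Equiv.Perm (Fin n)) : Set (FlagVariety n) :=
  {p | p ∈ hess c h ∧
    Tendsto (fun t : ℂˣ => oneParam lam t • p)
      (comap (fun t : ℂˣ => (t : ℂ)) (Bornology.cobounded ℂ))
      (𝓝 ((permGL w : GL (Fin n) ℂ) : FlagVariety n))}

/-- Lower triangular matrices having `1` on the diagonal. -/
def IsLowerUnitriangular {n : ℕ} (x : Matrix (Fin n) (Fin n) ℂ) : Prop :=
  (∀ i, x i i = 1) ∧ ∀ i j, i < j → x i j = 0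

/-- The lower triangular matrices `x` having `1` on the diagonal with `ẇ x` in the minus cell. -/
def cellMatrices {n : ℕ} (lam : Fin n → ℤ) (c : Fin n → ℂ) (h : Fin n → Fin n)
    (w : Equiv.Perm (Fin n)) : Set (Matrix (Fin n) (Fin n) ℂ) :=
  {x | IsLowerUnitriangular x ∧
    ∃ u : GL (Fin n) ℂ, (u : Matrix (Fin n) (Fin n) ℂ) = x ∧
      ((permGL w * u : GL (Fin n) ℂ) : FlagVariety n) ∈ minusCell lam c h w}

/-! ### The entries as polynomials in the free variables -/

/-- Polynomials over `ℂ` in the free variables `x_{i,j}`, one for each edge `j → i`;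
the edge `j → i` is the pair `(j, i)`. -/
abbrev FreePoly {n : ℕ} (w : Equiv.Perm (Fin n)) (h : Fin n → Fin n) : Type :=
  MvPolynomial {e : Fin n × Fin n // Edge w h e.1 e.2} ℂ

/-- `X` is the general element of `cellMatrices`, its entries written as polynomials in the free
variables: the entry at an edge is the corresponding variable, and substituting all complex
values for the variables gives exactly the elements of `cellMatrices`. -/
structure IsGeneralElement {n : ℕ} (lam : Fin n → ℤ) (c : Fin n → ℂ) (h : Fin n → Fin n)
    (w : Equiv.Perm (Fin n)) (X : Matrix (Fin n) (Fin n) (FreePoly w h)) : Prop where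
  free : ∀ e : {e : Fin n × Fin n // Edge w h e.1 e.2}, X e.1.2 e.1.1 = MvPolynomial.X e
  range_eq : Set.range (fun v : {e : Fin n × Fin n // Edge w h e.1 e.2} → ℂ =>
    X.map (MvPolynomial.eval v)) = cellMatrices lam c h w

end HessCell

end

/-!
Write `D = diag(d_1, …, d_n)` with `d_i = c_{w(i)}`. A lower unitriangular `x` has `ẇ x B` in the
minus cell exactly if `x⁻¹ D x = D + Y` with `Y` supported on the edges of the graph, that is, if
`D x - x D = x Y` (`IsEigenPair`, `mem_cellMatrices_iff`). The Hessenberg condition says that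
`Y i j = 0` for `i > h j`, and the limit condition says that `x i j = 0` unless
`w j ≤ w i`, because near the identity the lower unitriangular factor of a matrix depends
continuously on the matrix.

Entrywise the equation reads `(d_i - d_j) x_{ij} = Y_{ij} + ∑_{j<k<i} x_{ik} Y_{kj}`. At an edge it
gives `Y_{ij}` from `x_{ij}`, and elsewhere it gives `x_{ij}`, since there `Y_{ij} = 0`. Hence the
entries of `x` are polynomials in its entries at the edges (`existsUnique_isGeneralElement`).
Moreover `x_{ij} ≠ 0` forces `i` to be reachable from `j`, so a nonzero minor gives a matching of
`B` with `A` through one nonzero term of its Leibniz expansion.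

For the converse it suffices to find one `d` and one `Y` for which the minor of `x` is nonzero. The
matching may be assumed to fix `A ∩ B` (`exists_matching_fixing_inter`). Row `i` of `x` is the left
eigenvector of `D + Y` for `d_i`. Let the eigenvalues of each matched pair `b ≠ a` collide, as
`d_a - d_b = O(ε)`, all other differences staying away from `0`. Then `ε` times row `a` of `x` tends
to a multiple of row `b` (`tendsto_mul_eigenRow`). The factor is a residue that is nonzero for
generic `Y`, because `a` is reachable from `b` (`exists_forall_eigenResidue_ne_zero`). Up to nonzero
factors, the minor with rows `A` and columns `B` therefore tends to the principal minor of `B`,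
which is `1` (`exists_det_eigenRow_ne_zero`).
-/

namespace HessCell

open Filter Topology Matrix

variable {n k : ℕ}

/-! ### The eigenpair equation -/

/-- `x` and `Y` solve `D x - x D = x Y` for `D = diag(d_1, …, d_n)`, where `x` is lower
unitriangular and `Y` is supported on the edges. In other words, row `i` of `x` is a left
eigenvector of `D + Y` with eigenvalue `d_i`, normalized to have entry `1` at `i`. -/
structure IsEigenPair {R : Type*} [CommRing R] [Algebra ℂ R] (w : Equiv.Perm (Fin n))
    (h : Fin n → Fin n) (d : Fin n → ℂ) (x Y : Matrix (Fin n) (Fin n) R) : Prop where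
  diag : ∀ i, x i i = 1
  upper : ∀ i j, i < j → x i j = 0
  supp : ∀ i j, ¬ Edge w h j i → Y i j = 0
  eqn : ∀ i j, (d i - d j) • x i j = ∑ k, x i k * Y k j

theorem sum_mul_eq_add {R : Type*} [CommRing R] {x Y : Matrix (Fin n) (Fin n) R}
    (hdiag : ∀ i, x i i = 1) (hupper : ∀ i j, i < j → x i j = 0)
    (hY : ∀ i j, i ≤ j → Y i j = 0) (i j : Fin n) :
    ∑ k, x i k * Y k j = (∑ k, if j < k ∧ k < i then x i k * Y k j else 0) + Y i j := by
  have : Y i j = ∑ k, if k = i then Y i j else 0 := by simp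
  rw [this, ← Finset.sum_add_distrib]
  refine Finset.sum_congr rfl fun k _ => ?_
  rcases lt_trichotomy k i with hk | rfl | hk
  · by_cases hj : j < k
    · simp [hk, hj, hk.ne]
    · simp [hj, hk.ne, hY k j (not_lt.1 hj)]
  · simp [hdiag]
  · simp [hk.not_gt, hk.ne', hupper i k hk]

section

variable {R : Type*} [CommRing R] [Algebra ℂ R] {w : Equiv.Perm (Fin n)} {h : Fin n → Fin n}
  {d : Fin n → ℂ} {x Y x' Y' : Matrix (Fin n) (Fin n) R}

theorem Edge.lt {i j : Fin n} (e : Edge w h j i) : j < i := e.1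

namespace IsEigenPair

theorem eq_zero_of_le (H : IsEigenPair w h d x Y) {i j : Fin n} (hij : i ≤ j) : Y i j = 0 :=
  H.supp i j fun e => e.lt.not_ge hij

theorem eqn_split (H : IsEigenPair w h d x Y) (i j : Fin n) :
    (d i - d j) • x i j = (∑ k, if j < k ∧ k < i then x i k * Y k j else 0) + Y i j := by
  rw [H.eqn, sum_mul_eq_add H.diag H.upper fun _ _ => H.eq_zero_of_le]

theorem map {R' : Type*} [CommRing R'] [Algebra ℂ R'] (H : IsEigenPair w h d x Y)
    (f : R →ₐ[ℂ] R') : IsEigenPair w h d (x.map f) (Y.map f) where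
  diag i := by simp [H.diag]
  upper i j hij := by simp [H.upper i j hij]
  supp i j hij := by simp [H.supp i j hij]
  eqn i j := by simp [← map_smul, H.eqn]

/-- The matrix `x` of an eigenpair is determined by its entries at the edges. -/
theorem eq_of_edge (hd : Function.Injective d) (H : IsEigenPair w h d x Y)
    (H' : IsEigenPair w h d x' Y') (hx : ∀ i j, Edge w h j i → x i j = x' i j) : x = x' := by
  suffices ∀ m : ℕ, ∀ i j : Fin n, (i : ℕ) - j = m → x i j = x' i j ∧ Y i j = Y' i j by
    ext i j
    exact (this _ i j rfl).1
  intro m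
  induction m using Nat.strong_induction_on with
  | _ m ih =>
    rintro i j rfl
    have hs : (∑ k, if j < k ∧ k < i then x i k * Y k j else 0) =
        ∑ k, if j < k ∧ k < i then x' i k * Y' k j else 0 := by
      refine Finset.sum_congr rfl fun k _ => ?_
      split_ifs with hk
      · rw [(ih (i - k) (by have := hk.1; have := hk.2; omega) i k rfl).1,
          (ih (k - j) (by have := hk.1; have := hk.2; omega) k j rfl).2]
      · rfl
    have e := H.eqn_split i j
    have e' := H'.eqn_split i j
    rw [hs] at e
    by_cases hE : Edge w h j i
    · refine ⟨hx i j hE, ?_⟩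
      rw [hx i j hE, e'] at e
      exact (add_left_cancel e).symm
    · have hY : Y i j = Y' i j := by rw [H.supp i j hE, H'.supp i j hE]
      refine ⟨?_, hY⟩
      rw [hY, ← e'] at e
      by_cases hij : i = j
      · subst hij
        rw [H.diag, H'.diag]
      · have hne : d i - d j ≠ 0 := sub_ne_zero.2 fun hh => hij (hd hh)
        have := congrArg ((d i - d j)⁻¹ • ·) e
        simpa [smul_smul, inv_mul_cancel₀ hne] using this

theorem reachable_of_ne_zero (hd : Function.Injective d) (H : IsEigenPair w h d x Y)
    (i j : Fin n) (hx : x i j ≠ 0) : Reachable w h j i := by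
  suffices ∀ m : ℕ, ∀ j : Fin n, n - j = m → x i j ≠ 0 → Reachable w h j i from this _ j rfl hx
  intro m
  induction m using Nat.strong_induction_on with
  | _ m ih =>
    rintro j rfl hx
    by_cases hij : i = j
    · subst hij
      exact Relation.ReflTransGen.refl
    · have hne : d i - d j ≠ 0 := sub_ne_zero.2 fun hh => hij (hd hh)
      have hs : ∑ k, x i k * Y k j ≠ 0 := by
        rw [← H.eqn]
        intro h0
        have := congrArg ((d i - d j)⁻¹ • ·) h0
        exact hx (by simpa [smul_smul, inv_mul_cancel₀ hne] using this)
      obtain ⟨k, -, hk⟩ := Finset.exists_ne_zero_of_sum_ne_zero hs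
      have hE : Edge w h j k := by
        by_contra hE
        exact hk (by rw [H.supp k j hE, mul_zero])
      have hjk := hE.lt
      exact Relation.ReflTransGen.head hE
        (ih (n - k) (by omega) k rfl fun h0 => hk (by rw [h0, zero_mul]))

end IsEigenPair

theorem Reachable.le {i j : Fin n} (hr : Reachable w h j i) : j ≤ i ∧ w j ≤ w i := by
  induction hr with
  | refl => exact ⟨le_rfl, le_rfl⟩
  | tail _ e ih => exact ⟨ih.1.trans e.1.le, ih.2.trans e.2.2.le⟩

open Classical in
/-- Simultaneous recursion for the entries `x i j` and `Y i j` of the eigenpair in which `x` has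
the prescribed entries `v i j` at the edges: at an edge the equation is solved for `Y i j`,
elsewhere for `x i j`. -/
noncomputable def eigenPairOfEdges (w : Equiv.Perm (Fin n)) (h : Fin n → Fin n) (d : Fin n → ℂ)
    (v : Matrix (Fin n) (Fin n) R) (i j : Fin n) : R × R :=
  let s := ∑ k : Fin n, if _hk : j < k ∧ k < i then
    (eigenPairOfEdges w h d v i k).1 * (eigenPairOfEdges w h d v k j).2 else 0
  if Edge w h j i then (v i j, (d i - d j) • v i j - s)
  else if i = j then (1, 0) else ((d i - d j)⁻¹ • s, 0)
termination_by (i : ℕ) - j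
decreasing_by
  all_goals
    have := _hk.1
    have := _hk.2
    omega

theorem isEigenPair_eigenPairOfEdges (hd : Function.Injective d)
    (v : Matrix (Fin n) (Fin n) R) :
    IsEigenPair w h d (Matrix.of fun i j => (eigenPairOfEdges w h d v i j).1)
      (Matrix.of fun i j => (eigenPairOfEdges w h d v i j).2) := by
  have hdiag : ∀ i, (eigenPairOfEdges w h d v i i).1 = 1 := fun i => by
    rw [eigenPairOfEdges]
    simp [Edge]
  have hupper : ∀ i j, i < j → (eigenPairOfEdges w h d v i j).1 = 0 := fun i j hij => by
    rw [eigenPairOfEdges]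
    have : ∀ k, ¬ (j < k ∧ k < i) := fun k hk => (hk.1.trans hk.2).not_gt hij
    simp [Edge, hij.not_gt, hij.ne, this]
  have hsupp : ∀ i j, ¬ Edge w h j i → (eigenPairOfEdges w h d v i j).2 = 0 := fun i j hE => by
    rw [eigenPairOfEdges]
    simp only [hE, if_false]
    split_ifs <;> rfl
  refine ⟨hdiag, hupper, hsupp, fun i j => ?_⟩
  rw [sum_mul_eq_add (x := Matrix.of fun i j => (eigenPairOfEdges w h d v i j).1)
    (Y := Matrix.of fun i j => (eigenPairOfEdges w h d v i j).2) hdiag hupper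
    fun i j hij => hsupp i j fun e => e.lt.not_ge hij]
  simp only [Matrix.of_apply]
  by_cases hE : Edge w h j i
  · rw [eigenPairOfEdges]
    simp [hE]
  · by_cases hij : i = j
    · subst hij
      have : ∀ k, ¬ (i < k ∧ k < i) := fun k hk => (hk.1.trans hk.2).false
      simp [hsupp i i hE, this]
    · have hne : d i - d j ≠ 0 := sub_ne_zero.2 fun hh => hij (hd hh)
      rw [eigenPairOfEdges]
      simp [hE, hij, smul_smul, mul_inv_cancel₀ hne]

theorem eigenPairOfEdges_edge (v : Matrix (Fin n) (Fin n) R) {i j : Fin n} (e : Edge w h j i) :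
    (eigenPairOfEdges w h d v i j).1 = v i j := by
  rw [eigenPairOfEdges]
  simp [e]

/-- The solution `x` of `D x - x D = x Y` for given `Y`, row by row: the entry `x i j` is computed
from the entries `x i k` with `k > j`. It is defined even if `d` is not injective; the entries
`x i j` with `d i = d j`, `j < i` are then set to `0`. -/
noncomputable def eigenRow (d : Fin n → ℂ) (Y : Matrix (Fin n) (Fin n) R) (i j : Fin n) : R :=
  if i = j then 1 else if j < i then (d i - d j)⁻¹ •
    ∑ k : Fin n, if _hk : j < k then eigenRow d Y i k * Y k j else 0
  else 0
termination_by n - (j : ℕ)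
decreasing_by
  have : (j : ℕ) < k := _hk
  omega

theorem eigenRow_self (i : Fin n) : eigenRow d Y i i = 1 := by
  rw [eigenRow]
  simp

theorem eigenRow_of_lt {i j : Fin n} (hij : i < j) : eigenRow d Y i j = 0 := by
  rw [eigenRow]
  simp [hij.ne, hij.not_gt]

theorem eigenRow_of_gt (d : Fin n → ℂ) (Y : Matrix (Fin n) (Fin n) R) {i j : Fin n}
    (hij : j < i) : eigenRow d Y i j =
      (d i - d j)⁻¹ • ∑ k : Fin n, if j < k then eigenRow d Y i k * Y k j else 0 := by
  rw [eigenRow]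
  simp [hij.ne', hij]

/-- Downward induction on an element of `Fin n`. -/
theorem fin_down_induction {P : Fin n → Prop} (H : ∀ j, (∀ k, j < k → P k) → P j) (j : Fin n) :
    P j :=
  WellFoundedGT.induction j H

theorem map_eigenRow {R' : Type*} [CommRing R'] [Algebra ℂ R'] (f : R →ₐ[ℂ] R') (i j : Fin n) :
    f (eigenRow d Y i j) = eigenRow d (Y.map f) i j := by
  induction j using fin_down_induction with
  | H j ih =>
    rcases lt_trichotomy i j with hij | rfl | hij
    · simp [eigenRow_of_lt hij]
    · simp [eigenRow_self]
    · rw [eigenRow_of_gt _ _ hij, eigenRow_of_gt _ _ hij, map_smul, map_sum]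
      congr 1
      refine Finset.sum_congr rfl fun k _ => ?_
      split_ifs with hk
      · rw [map_mul, ih k hk, Matrix.map_apply]
      · exact map_zero f

theorem eigenRow_congr (i j : Fin n) (hY : ∀ k l, j ≤ l → Y k l = Y' k l) :
    eigenRow d Y i j = eigenRow d Y' i j := by
  induction j using fin_down_induction with
  | H j ih =>
    rcases lt_trichotomy i j with hij | rfl | hij
    · simp [eigenRow_of_lt hij]
    · simp [eigenRow_self]
    · rw [eigenRow_of_gt _ _ hij, eigenRow_of_gt _ _ hij]
      congr 1
      refine Finset.sum_congr rfl fun k _ => ?_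
      split_ifs with hk
      · rw [ih k hk fun a l hl => hY a l (hk.le.trans hl), hY k j le_rfl]
      · rfl

theorem isEigenPair_eigenRow (hd : Function.Injective d)
    (hY : ∀ i j, ¬ Edge w h j i → Y i j = 0) :
    IsEigenPair w h d (Matrix.of (eigenRow d Y)) Y := by
  have hs : ∀ i j, ∑ k, eigenRow d Y i k * Y k j =
      ∑ k, if j < k then eigenRow d Y i k * Y k j else 0 := fun i j => by
    refine Finset.sum_congr rfl fun k _ => ?_
    split_ifs with hk
    · rfl
    · rw [hY k j fun e => hk e.lt, mul_zero]
  refine ⟨fun i => eigenRow_self i, fun i j hij => eigenRow_of_lt hij, hY, fun i j => ?_⟩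
  simp only [Matrix.of_apply]
  rw [hs]
  by_cases hij : j < i
  · have hne : d i - d j ≠ 0 := sub_ne_zero.2 fun hh => hij.ne' (hd hh)
    rw [eigenRow_of_gt _ _ hij, smul_smul, mul_inv_cancel₀ hne, one_smul]
  · rw [Finset.sum_eq_zero]
    · rcases (not_lt.1 hij).eq_or_lt with rfl | hlt
      · simp
      · rw [eigenRow_of_lt hlt, smul_zero]
    · intro k _
      split_ifs with hk
      · rw [eigenRow_of_lt (lt_of_le_of_lt (not_lt.1 hij) hk), zero_mul]
      · rfl

end

/-! ### Convergence to the base point of the flag variety -/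

/-- Uniqueness and continuity of the factorization into a lower unitriangular and an upper
triangular factor, near the identity: if `z b → 1`, then `z → 1`. -/
theorem tendsto_lowerUnitriangular_of_mul {ι : Type*} {l : Filter ι}
    {z b : ι → Matrix (Fin n) (Fin n) ℂ} (hz : ∀ t, IsLowerUnitriangular (z t))
    (hb : ∀ t i j, j < i → b t i j = 0) (hzb : Tendsto (fun t => z t * b t) l (𝓝 1)) :
    Tendsto z l (𝓝 1) := by
  have hg : ∀ i j, Tendsto (fun t => (z t * b t) i j) l
      (𝓝 ((1 : Matrix (Fin n) (Fin n) ℂ) i j)) := fun i j =>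
    ((continuous_id.matrix_elem i j).tendsto _).comp hzb
  suffices ∀ m : Fin n, (∀ j, Tendsto (fun t => b t m j) l
      (𝓝 ((1 : Matrix (Fin n) (Fin n) ℂ) m j))) ∧
      ∀ i, Tendsto (fun t => z t i m) l (𝓝 ((1 : Matrix (Fin n) (Fin n) ℂ) i m)) by
    exact tendsto_pi_nhds.2 fun i => tendsto_pi_nhds.2 fun j => (this j).2 i
  intro m
  induction m using WellFoundedLT.induction with
  | _ m ih =>
    have hsum : ∀ i j, Tendsto (fun t => (z t * b t) i j - ∑ k, if k < m then z t i k * b t k j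
        else 0) l (𝓝 ((1 : Matrix (Fin n) (Fin n) ℂ) i j -
          ∑ k, if k < m then (1 : Matrix (Fin n) (Fin n) ℂ) i k * (1 : Matrix _ _ ℂ) k j
            else 0)) := by
      refine fun i j => (hg i j).sub (tendsto_finsetSum _ fun k _ => ?_)
      by_cases hk : k < m
      · simp only [hk, if_true]
        exact ((ih k hk).2 i).mul ((ih k hk).1 j)
      · simp only [hk, if_false]
        exact tendsto_const_nhds
    have hb' : ∀ j, Tendsto (fun t => b t m j) l
        (𝓝 ((1 : Matrix (Fin n) (Fin n) ℂ) m j)) := by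
      intro j
      convert hsum m j using 1
      · ext t
        rw [Matrix.mul_apply, ← Finset.sum_sub_distrib, Finset.sum_eq_single m]
        · simp [(hz t).1]
        · intro k _ hk
          rcases lt_or_gt_of_ne hk with hk | hk
          · simp [hk]
          · simp [hk.not_gt, (hz t).2 m k hk]
        · simp
      · rw [Finset.sum_eq_zero, sub_zero]
        intro k _
        split_ifs with hk
        · rw [Matrix.one_apply_ne hk.ne', zero_mul]
        · rfl
    refine ⟨hb', fun i => ?_⟩
    have hm : Tendsto (fun t => z t i m * b t m m) l
        (𝓝 ((1 : Matrix (Fin n) (Fin n) ℂ) i m)) := by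
      convert hsum i m using 1
      · ext t
        rw [Matrix.mul_apply, ← Finset.sum_sub_distrib, Finset.sum_eq_single m]
        · simp
        · intro k _ hk
          rcases lt_or_gt_of_ne hk with hk | hk
          · simp [hk]
          · simp [hk.not_gt, hb t k m hk]
        · simp
      · rw [Finset.sum_eq_zero, sub_zero]
        intro k _
        split_ifs with hk
        · rw [Matrix.one_apply_ne hk.ne, mul_zero]
        · rfl
    have hbm : Tendsto (fun t => b t m m) l (𝓝 1) := by simpa using hb' m
    have hdiv := hm.div hbm one_ne_zero
    rw [div_one] at hdiv
    refine hdiv.congr' ?_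
    filter_upwards [hbm.eventually_ne one_ne_zero] with t ht
    simp [ht]

theorem tendsto_gl_iff {ι : Type*} {l : Filter ι} {g : ι → GL (Fin n) ℂ} {g₀ : GL (Fin n) ℂ} :
    Tendsto g l (𝓝 g₀) ↔ Tendsto (fun t => (g t : Matrix (Fin n) (Fin n) ℂ)) l (𝓝 g₀) := by
  let _ : NormedRing (Matrix (Fin n) (Fin n) ℂ) := Matrix.linftyOpNormedRing
  let _ : NormedAlgebra ℂ (Matrix (Fin n) (Fin n) ℂ) := Matrix.linftyOpNormedAlgebra
  have : CompleteSpace (Matrix (Fin n) (Fin n) ℂ) := FiniteDimensional.complete ℂ _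
  exact Units.isOpenEmbedding_val.isInducing.tendsto_nhds_iff

/-- A family of lower unitriangular matrices that converges to the base point in the flag variety
converges to the identity. -/
theorem tendsto_one_of_tendsto_mk {ι : Type*} {l : Filter ι} {z : ι → GL (Fin n) ℂ}
    (hz : ∀ t, IsLowerUnitriangular (z t : Matrix (Fin n) (Fin n) ℂ))
    (h : Tendsto (fun t => (z t : FlagVariety n)) l (𝓝 ((1 : GL (Fin n) ℂ) : FlagVariety n))) :
    Tendsto (fun t => (z t : Matrix (Fin n) (Fin n) ℂ)) l (𝓝 1) := by
  -- The limit is lifted to `GL_n` through the pairs `(z, b)` with `z b` close to `1`.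
  let P := {p : GL (Fin n) ℂ × GL (Fin n) ℂ //
    IsLowerUnitriangular (p.1 : Matrix (Fin n) (Fin n) ℂ) ∧ p.2 ∈ borel n}
  let F : Filter P := comap (fun p : P => p.1.1 * p.1.2) (𝓝 1)
  have key : Tendsto (fun p : P => (p.1.1 : Matrix (Fin n) (Fin n) ℂ)) F (𝓝 1) := by
    refine tendsto_lowerUnitriangular_of_mul
      (b := fun p : P => (p.1.2 : Matrix (Fin n) (Fin n) ℂ)) (fun p => p.2.1)
      (fun p i j hij => p.2.2 hij) ?_
    simpa using tendsto_gl_iff.1 (tendsto_comap (f := fun p : P => p.1.1 * p.1.2) (x := 𝓝 1))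
  intro Z hZ
  obtain ⟨W, hW, hWZ⟩ := mem_comap.1 (key hZ)
  have hWm : (QuotientGroup.mk '' W : Set (FlagVariety n)) ∈
      𝓝 ((1 : GL (Fin n) ℂ) : FlagVariety n) := QuotientGroup.isOpenMap_coe.image_mem_nhds hW
  have hev : ∀ᶠ t in l, (z t : FlagVariety n) ∈ (QuotientGroup.mk '' W : Set (FlagVariety n)) :=
    h hWm
  change ∀ᶠ t in l, (z t : Matrix (Fin n) (Fin n) ℂ) ∈ Z
  filter_upwards [hev] with t ht
  obtain ⟨g, hg, hgt⟩ := ht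
  have hmem : (z t)⁻¹ * g ∈ borel n := QuotientGroup.eq.1 hgt.symm
  exact hWZ (show (⟨(z t, (z t)⁻¹ * g), hz t, hmem⟩ : P) ∈ _ by
    simpa using hg)

/-! ### The Hessenberg and limit conditions on matrices -/

theorem mem_colSpan_iff (g : GL (Fin n) ℂ) (i : Fin n) (v : Fin n → ℂ) :
    v ∈ colSpan g i ↔
      ∀ r, i < r → (((g⁻¹ : GL (Fin n) ℂ) : Matrix (Fin n) (Fin n) ℂ) *ᵥ v) r = 0 := by
  constructor
  · intro hv r hr
    induction hv using Submodule.span_induction with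
    | mem v hv =>
      obtain ⟨j, hj, rfl⟩ := hv
      have : (((g⁻¹ : GL (Fin n) ℂ) : Matrix (Fin n) (Fin n) ℂ) *
          (g : Matrix (Fin n) (Fin n) ℂ)) r j = 0 := by
        rw [Units.inv_mul, Matrix.one_apply_ne (lt_of_le_of_lt hj hr).ne']
      simpa [Matrix.mul_apply, Matrix.mulVec, dotProduct] using this
    | zero => simp
    | add a b _ _ ha hb => rw [Matrix.mulVec_add, Pi.add_apply, ha, hb, add_zero]
    | smul a b _ hb => rw [Matrix.mulVec_smul, Pi.smul_apply, hb, smul_zero]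
  · intro hv
    have hsum : v = ∑ r, (((g⁻¹ : GL (Fin n) ℂ) : Matrix (Fin n) (Fin n) ℂ) *ᵥ v) r •
        (g : Matrix (Fin n) (Fin n) ℂ).col r := by
      conv_lhs => rw [← Matrix.one_mulVec v, ← Units.mul_inv g, ← Matrix.mulVec_mulVec]
      ext a
      simp [Matrix.mulVec, dotProduct, mul_comm]
    rw [hsum]
    refine Submodule.sum_mem _ fun r _ => ?_
    by_cases hr : r ≤ i
    · exact Submodule.smul_mem _ _ (Submodule.subset_span ⟨r, hr, rfl⟩)
    · rw [hv r (not_le.1 hr), zero_smul]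
      exact Submodule.zero_mem _

theorem mk_mem_hess_iff {h : Fin n → Fin n} (hh : IsHessenberg h) (c : Fin n → ℂ)
    (g : GL (Fin n) ℂ) : (g : FlagVariety n) ∈ hess c h ↔
      ∀ i r, h i < r → (((g⁻¹ : GL (Fin n) ℂ) : Matrix (Fin n) (Fin n) ℂ) *
        (Matrix.diagonal c * (g : Matrix (Fin n) (Fin n) ℂ))) r i = 0 := by
  have hcol : ∀ j r, (((g⁻¹ : GL (Fin n) ℂ) : Matrix (Fin n) (Fin n) ℂ) *ᵥ
      (Matrix.toLin' (Matrix.diagonal c) ((g : Matrix (Fin n) (Fin n) ℂ).col j))) r =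
      (((g⁻¹ : GL (Fin n) ℂ) : Matrix (Fin n) (Fin n) ℂ) *
        (Matrix.diagonal c * (g : Matrix (Fin n) (Fin n) ℂ))) r j := fun j r => by
    simp [Matrix.mul_apply, Matrix.mulVec, dotProduct, Matrix.diagonal_apply]
  constructor
  · intro hg i r hr
    have := hg i (Submodule.mem_map_of_mem (Submodule.subset_span ⟨i, Set.mem_Iic.2 le_rfl, rfl⟩))
    rw [← hcol]
    exact (mem_colSpan_iff g (h i) _).1 this r hr
  · intro hg i
    rw [flagStep_mk, flagStep_mk, colSpan, Submodule.map_span_le]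
    rintro _ ⟨j, hj, rfl⟩
    refine (mem_colSpan_iff g (h i) _).2 fun r hr => ?_
    rw [hcol]
    exact hg j r (lt_of_le_of_lt (hh.1 hj) hr)

theorem permGL_mul_apply (w : Equiv.Perm (Fin n)) (M : Matrix (Fin n) (Fin n) ℂ) (i j : Fin n) :
    ((permGL w : Matrix (Fin n) (Fin n) ℂ) * M) (w i) j = M i j := by
  simp [permGL, Matrix.mul_apply]

theorem oneParam_mul_permGL (w : Equiv.Perm (Fin n)) (lam : Fin n → ℤ) (t : ℂˣ) :
    oneParam lam t * permGL w = permGL w * oneParam (lam ∘ w) t := by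
  ext i j
  obtain ⟨i, rfl⟩ := w.surjective i
  rw [Units.val_mul, Units.val_mul, permGL_mul_apply]
  by_cases hij : i = j
  · simp [oneParam, permGL, hij]
  · simp [oneParam, permGL, hij]

theorem oneParam_mem_borel (lam : Fin n → ℤ) (t : ℂˣ) : oneParam lam t ∈ borel n :=
  Matrix.blockTriangular_diagonal _

theorem conj_oneParam_apply (lam : Fin n → ℤ) (t : ℂˣ) (u : GL (Fin n) ℂ) (i j : Fin n) :
    ((oneParam lam t * u * (oneParam lam t)⁻¹ : GL (Fin n) ℂ) : Matrix (Fin n) (Fin n) ℂ) i j =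
      (t : ℂ) ^ (lam i - lam j) * (u : Matrix (Fin n) (Fin n) ℂ) i j := by
  have hinv : (((oneParam lam t)⁻¹ : GL (Fin n) ℂ) : Matrix (Fin n) (Fin n) ℂ) =
      Matrix.diagonal fun i => (((t ^ lam i)⁻¹ : ℂˣ) : ℂ) := rfl
  have hval : (oneParam lam t : Matrix (Fin n) (Fin n) ℂ) =
      Matrix.diagonal fun i => ((t ^ lam i : ℂˣ) : ℂ) := rfl
  rw [Units.val_mul, Units.val_mul, hinv, hval, Matrix.mul_diagonal, Matrix.diagonal_mul,
    zpow_sub₀ t.ne_zero]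
  push_cast
  ring

theorem tendsto_zpow_neg {m : ℤ} (hm : m < 0) :
    Tendsto (fun t : ℂˣ => (t : ℂ) ^ m)
      (comap (fun t : ℂˣ => (t : ℂ)) (Bornology.cobounded ℂ)) (𝓝 0) := by
  obtain ⟨k, rfl⟩ : ∃ k : ℕ, m = -((k + 1 : ℕ) : ℤ) := ⟨(-m).toNat - 1, by omega⟩
  have h1 : Tendsto (fun t : ℂˣ => ((t : ℂ))⁻¹)
      (comap (fun t : ℂˣ => (t : ℂ)) (Bornology.cobounded ℂ)) (𝓝 0) :=
    tendsto_inv₀_cobounded.comp tendsto_comap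
  have h2 := h1.pow (k + 1)
  rw [zero_pow k.succ_ne_zero] at h2
  refine h2.congr fun t => ?_
  rw [_root_.zpow_neg, zpow_natCast, inv_pow]

/-- The sequence `1, 2, 3, …` tends to infinity in `ℂˣ`. -/
theorem tendsto_natCast_units :
    Tendsto (fun N : ℕ => Units.mk0 ((N : ℂ) + 1) (Nat.cast_add_one_ne_zero N)) atTop
      (comap (fun t : ℂˣ => (t : ℂ)) (Bornology.cobounded ℂ)) := by
  rw [tendsto_comap_iff]
  refine tendsto_norm_atTop_iff_cobounded.1 ?_
  have : ∀ N : ℕ, ‖((fun t : ℂˣ => (t : ℂ)) ∘ fun N : ℕ => Units.mk0 ((N : ℂ) + 1)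
      (Nat.cast_add_one_ne_zero N)) N‖ = (N : ℝ) + 1 := fun N => by
    simpa using Complex.norm_natCast (N + 1)
  simp only [this]
  exact tendsto_atTop_add_const_right _ _ tendsto_natCast_atTop_atTop

theorem eq_zero_of_tendsto_zpow_mul {m : ℤ} (hm : 0 ≤ m) {a : ℂ}
    (h : Tendsto (fun t : ℂˣ => (t : ℂ) ^ m * a)
      (comap (fun t : ℂˣ => (t : ℂ)) (Bornology.cobounded ℂ)) (𝓝 0)) : a = 0 := by
  lift m to ℕ using hm
  have h1 := (h.comp tendsto_natCast_units).norm
  rw [norm_zero] at h1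
  refine norm_le_zero_iff.1 (ge_of_tendsto' h1 fun N => ?_)
  have hN : ‖(N : ℂ) + 1‖ = (N : ℝ) + 1 := by simpa using Complex.norm_natCast (N + 1)
  simp only [Function.comp_apply, Units.val_mk0, zpow_natCast, norm_mul, norm_pow, hN]
  exact le_mul_of_one_le_left (norm_nonneg _) (one_le_pow₀ (by simp))

/-- The attracting condition of the minus cell is a condition on the support: `ẇ u B` flows to
`ẇ B` exactly if `u i j` vanishes whenever `w i < w j`. -/
theorem tendsto_oneParam_smul_iff (w : Equiv.Perm (Fin n)) {lam : Fin n → ℤ} (hlam : StrictAnti lam)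
    {u : GL (Fin n) ℂ} (hu : IsLowerUnitriangular (u : Matrix (Fin n) (Fin n) ℂ)) :
    Tendsto (fun t : ℂˣ => oneParam lam t • ((permGL w * u : GL (Fin n) ℂ) : FlagVariety n))
      (comap (fun t : ℂˣ => (t : ℂ)) (Bornology.cobounded ℂ))
      (𝓝 ((permGL w : GL (Fin n) ℂ) : FlagVariety n)) ↔
    ∀ i j, (u : Matrix (Fin n) (Fin n) ℂ) i j ≠ 0 → w j ≤ w i := by
  let z : ℂˣ → GL (Fin n) ℂ := fun t =>
    oneParam (lam ∘ w) t * u * (oneParam (lam ∘ w) t)⁻¹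
  have hz : ∀ t i j, (z t : Matrix (Fin n) (Fin n) ℂ) i j =
      (t : ℂ) ^ (lam (w i) - lam (w j)) * (u : Matrix (Fin n) (Fin n) ℂ) i j := fun t i j =>
    conj_oneParam_apply (lam ∘ w) t u i j
  have hzl : ∀ t, IsLowerUnitriangular (z t : Matrix (Fin n) (Fin n) ℂ) := fun t =>
    ⟨fun i => by rw [hz, hu.1]; simp, fun i j hij => by rw [hz, hu.2 i j hij, mul_zero]⟩
  have h1 : ∀ t : ℂˣ, oneParam lam t • ((permGL w * u : GL (Fin n) ℂ) : FlagVariety n) =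
      permGL w • ((z t : GL (Fin n) ℂ) : FlagVariety n) := fun t => by
    have e1 : oneParam lam t • ((permGL w * u : GL (Fin n) ℂ) : FlagVariety n) =
      ((oneParam lam t * (permGL w * u) : GL (Fin n) ℂ) : FlagVariety n) := rfl
    have e2 : permGL w • ((z t : GL (Fin n) ℂ) : FlagVariety n) =
      ((permGL w * z t : GL (Fin n) ℂ) : FlagVariety n) := rfl
    rw [e1, e2, QuotientGroup.eq]
    have : (oneParam lam t * (permGL w * u))⁻¹ * (permGL w * z t) =
        (oneParam (lam ∘ w) t)⁻¹ := by
      rw [← mul_assoc (oneParam lam t), oneParam_mul_permGL]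
      simp only [z]
      group
    rw [this]
    exact (borel n).inv_mem (oneParam_mem_borel _ _)
  have h2 : ((permGL w : GL (Fin n) ℂ) : FlagVariety n) =
      permGL w • ((1 : GL (Fin n) ℂ) : FlagVariety n) := by
    have e2 : permGL w • ((1 : GL (Fin n) ℂ) : FlagVariety n) =
      ((permGL w * 1 : GL (Fin n) ℂ) : FlagVariety n) := rfl
    rw [e2, mul_one]
  simp only [h1]
  rw [h2, tendsto_const_smul_iff]
  constructor
  · intro ht i j hij
    by_contra hw
    rw [not_le] at hw
    have hne : i ≠ j := fun e => hw.ne (congrArg w e)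
    have h3 := (((continuous_id.matrix_elem i j).tendsto _).comp
      (tendsto_one_of_tendsto_mk hzl ht))
    have h4 : Tendsto (fun t : ℂˣ => (t : ℂ) ^ (lam (w i) - lam (w j)) *
        (u : Matrix (Fin n) (Fin n) ℂ) i j)
        (comap (fun t : ℂˣ => (t : ℂ)) (Bornology.cobounded ℂ)) (𝓝 0) := by
      have := h3.congr (f₂ := fun t : ℂˣ => (t : ℂ) ^ (lam (w i) - lam (w j)) *
        (u : Matrix (Fin n) (Fin n) ℂ) i j) fun t => hz t i j
      simpa [Matrix.one_apply_ne hne] using this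
    exact hij (eq_zero_of_tendsto_zpow_mul (sub_nonneg.2 (hlam hw).le) h4)
  · intro hs
    refine (continuous_quotient_mk'.tendsto _).comp (tendsto_gl_iff.2 ?_)
    refine tendsto_pi_nhds.2 fun i => tendsto_pi_nhds.2 fun j => ?_
    refine Tendsto.congr (fun t => (hz t i j).symm) ?_
    by_cases hij : i = j
    · subst hij
      simpa [hu.1] using tendsto_const_nhds
    · by_cases h0 : (u : Matrix (Fin n) (Fin n) ℂ) i j = 0
      · simpa [h0, Matrix.one_apply_ne hij] using tendsto_const_nhds
      · have hlt : w j < w i := lt_of_le_of_ne (hs i j h0) fun e => hij (w.injective e).symm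
        have := (tendsto_zpow_neg (sub_neg.2 (hlam hlt))).mul_const
          ((u : Matrix (Fin n) (Fin n) ℂ) i j)
        simpa [Matrix.one_apply_ne hij] using this

/-! ### The minus cell and its general element -/

theorem IsLowerUnitriangular.det_eq_one {x : Matrix (Fin n) (Fin n) ℂ}
    (hx : IsLowerUnitriangular x) : x.det = 1 := by
  rw [← Matrix.det_transpose, Matrix.det_of_isUpperTriangular]
  · simp [hx.1]
  · intro i j hij
    exact hx.2 j i hij

theorem permGL_mul_mul_eq_iff (w : Equiv.Perm (Fin n)) (c : Fin n → ℂ)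
    (u M : Matrix (Fin n) (Fin n) ℂ) :
    (permGL w : Matrix (Fin n) (Fin n) ℂ) * u * M =
        Matrix.diagonal c * ((permGL w : Matrix (Fin n) (Fin n) ℂ) * u) ↔
      u * M = Matrix.diagonal (c ∘ w) * u := by
  have e1 : ∀ i j, ((permGL w : Matrix (Fin n) (Fin n) ℂ) * u * M) (w i) j = (u * M) i j :=
    fun i j => by rw [Matrix.mul_assoc, permGL_mul_apply]
  have e2 : ∀ i j, (Matrix.diagonal c * ((permGL w : Matrix (Fin n) (Fin n) ℂ) * u)) (w i) j =
      (Matrix.diagonal (c ∘ w) * u) i j := fun i j => by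
    rw [Matrix.diagonal_mul, Matrix.diagonal_mul, permGL_mul_apply]
    rfl
  constructor
  · intro H
    ext i j
    rw [← e1, ← e2, H]
  · intro H
    ext i j
    obtain ⟨i, rfl⟩ := w.surjective i
    rw [e1, e2, H]

/-- The matrices of the minus cell are the solutions `x` of the eigenpair equation: here
`D + Y = x⁻¹ D x` is the operator `S` in the basis given by the columns of `ẇ x`. -/
theorem mem_cellMatrices_iff {h : Fin n → Fin n} (hh : IsHessenberg h) (w : Equiv.Perm (Fin n))
    {lam : Fin n → ℤ} (hlam : StrictAnti lam) {c : Fin n → ℂ} (hc : Function.Injective c)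
    {x : Matrix (Fin n) (Fin n) ℂ} :
    x ∈ cellMatrices lam c h w ↔
      ∃ Y : Matrix (Fin n) (Fin n) ℂ, IsEigenPair w h (c ∘ w) x Y := by
  constructor
  · rintro ⟨hx, u, rfl, hhess, hlim⟩
    rw [tendsto_oneParam_smul_iff w hlam hx] at hlim
    rw [mk_mem_hess_iff hh] at hhess
    set M : Matrix (Fin n) (Fin n) ℂ := (((permGL w * u)⁻¹ : GL (Fin n) ℂ) :
      Matrix (Fin n) (Fin n) ℂ) * (Matrix.diagonal c *
        ((permGL w * u : GL (Fin n) ℂ) : Matrix (Fin n) (Fin n) ℂ)) with hM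
    have hgM : (u : Matrix (Fin n) (Fin n) ℂ) * M = Matrix.diagonal (c ∘ w) * u := by
      rw [← permGL_mul_mul_eq_iff, ← Units.val_mul, hM, ← Matrix.mul_assoc, Units.mul_inv,
        Matrix.one_mul]
    let Y := M - Matrix.diagonal (c ∘ w)
    have heqn : ∀ i j, ((c ∘ w) i - (c ∘ w) j) • (u : Matrix (Fin n) (Fin n) ℂ) i j =
        ∑ k, (u : Matrix (Fin n) (Fin n) ℂ) i k * Y k j := fun i j => by
      rw [← Matrix.mul_apply, Matrix.mul_sub, hgM, Matrix.sub_apply, Matrix.diagonal_mul,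
        Matrix.mul_diagonal, smul_eq_mul]
      ring
    have hYsupp : ∀ i j, Y i j ≠ 0 → j < i ∧ w j < w i := by
      intro i
      induction i using WellFoundedLT.induction with
      | _ i ih =>
        intro j hij
        by_cases hu : ((c ∘ w) i - (c ∘ w) j) • (u : Matrix (Fin n) (Fin n) ℂ) i j = 0
        · obtain ⟨k, hki, hk⟩ : ∃ k, k < i ∧ (u : Matrix (Fin n) (Fin n) ℂ) i k * Y k j ≠ 0 := by
            by_contra! hcon
            rw [heqn, Finset.sum_eq_single i, hx.1, one_mul] at hu
            · exact hij hu
            · intro k _ hk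
              rcases lt_or_gt_of_ne hk with hk | hk
              · exact hcon k hk
              · rw [hx.2 i k hk, zero_mul]
            · simp
          have hY := ih k hki j (right_ne_zero_of_mul hk)
          exact ⟨hY.1.trans hki, hY.2.trans_le (hlim i k (left_ne_zero_of_mul hk))⟩
        · have hne : i ≠ j := by
            rintro rfl
            simp at hu
          have hu' := right_ne_zero_of_smul hu
          have hji : j < i := by
            by_contra hlt
            exact hu' (hx.2 i j (lt_of_le_of_ne (not_lt.1 hlt) hne))
          exact ⟨hji, lt_of_le_of_ne (hlim i j hu') fun e => hne (w.injective e).symm⟩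
    refine ⟨Y, hx.1, hx.2, fun i j hE => ?_, heqn⟩
    by_contra hY
    have hlt := hYsupp i j hY
    refine hE ⟨hlt.1, ?_, hlt.2⟩
    by_contra hle
    refine hY ?_
    simp only [Y, Matrix.sub_apply]
    rw [Matrix.diagonal_apply_ne _ hlt.1.ne', sub_zero]
    exact hhess j i (not_le.1 hle)
  · rintro ⟨Y, H⟩
    have hx : IsLowerUnitriangular x := ⟨H.diag, H.upper⟩
    let u : GL (Fin n) ℂ := Matrix.GeneralLinearGroup.mkOfDetNeZero x
      (by rw [hx.det_eq_one]; exact one_ne_zero)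
    have hu : (u : Matrix (Fin n) (Fin n) ℂ) = x := rfl
    refine ⟨hx, u, hu, ?_, ?_⟩
    · rw [mk_mem_hess_iff hh]
      have hxM : x * (Matrix.diagonal (c ∘ w) + Y) = Matrix.diagonal (c ∘ w) * x := by
        ext i j
        rw [Matrix.mul_add, Matrix.add_apply, Matrix.mul_diagonal, Matrix.diagonal_mul,
          Matrix.mul_apply, ← H.eqn, smul_eq_mul]
        ring
      intro i r hr
      rw [Units.val_mul, hu, ← (permGL_mul_mul_eq_iff w c x _).2 hxM, ← hu, ← Units.val_mul,
        ← Matrix.mul_assoc, Units.inv_mul, Matrix.one_mul, Matrix.add_apply,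
        Matrix.diagonal_apply_ne _ (lt_of_le_of_lt (hh.2 i) hr).ne',
        H.supp r i fun e => e.2.1.not_gt hr, add_zero]
    · refine (tendsto_oneParam_smul_iff w hlam (u := u) hx).2 fun i j hij => ?_
      exact (Reachable.le (H.reachable_of_ne_zero (hc.comp w.injective) i j hij)).2

open Classical in
/-- The matrix whose entry at the edge `j → i` is the variable of that edge, and whose other
entries are `0`. -/
noncomputable def edgeVariables (w : Equiv.Perm (Fin n)) (h : Fin n → Fin n) :
    Matrix (Fin n) (Fin n) (FreePoly w h) :=
  Matrix.of fun i j => if e : Edge w h j i then MvPolynomial.X ⟨(j, i), e⟩ else 0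

theorem map_edgeVariables {w : Equiv.Perm (Fin n)} {h : Fin n → Fin n}
    {Y : Matrix (Fin n) (Fin n) ℂ} (hY : ∀ i j, ¬ Edge w h j i → Y i j = 0) :
    (edgeVariables w h).map (MvPolynomial.aeval (R := ℂ)
      fun e : {e : Fin n × Fin n // Edge w h e.1 e.2} => Y e.1.2 e.1.1) = Y := by
  ext i j
  by_cases e : Edge w h j i
  · simp [edgeVariables, e]
  · simp [edgeVariables, e, hY i j e]

/-- The general element is unique, since each of its specializations is an eigenpair with
prescribed entries at the edges. -/
theorem existsUnique_isGeneralElement {h : Fin n → Fin n} (hh : IsHessenberg h)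
    (w : Equiv.Perm (Fin n)) {lam : Fin n → ℤ} (hlam : StrictAnti lam) {c : Fin n → ℂ}
    (hc : Function.Injective c) :
    ∃! X : Matrix (Fin n) (Fin n) (FreePoly w h), IsGeneralElement lam c h w X := by
  have hd : Function.Injective (c ∘ w) := hc.comp w.injective
  let X : Matrix (Fin n) (Fin n) (FreePoly w h) :=
    Matrix.of fun i j => (eigenPairOfEdges w h (c ∘ w) (edgeVariables w h) i j).1
  have hX := isEigenPair_eigenPairOfEdges (w := w) (h := h) hd (edgeVariables w h)
  have hedge : ∀ e : {e : Fin n × Fin n // Edge w h e.1 e.2},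
      X e.1.2 e.1.1 = MvPolynomial.X e := fun e => by
    have := eigenPairOfEdges_edge (w := w) (h := h) (d := c ∘ w) (edgeVariables w h) e.2
    simp only [X, Matrix.of_apply]
    rw [this]
    simp [edgeVariables, e.2]
  have heval : ∀ v : {e : Fin n × Fin n // Edge w h e.1 e.2} → ℂ,
      ∃ Y : Matrix (Fin n) (Fin n) ℂ,
        IsEigenPair w h (c ∘ w) (X.map (MvPolynomial.eval v)) Y := fun v => by
    exact ⟨_, hX.map (MvPolynomial.aeval v)⟩
  refine ⟨X, ⟨hedge, ?_⟩, ?_⟩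
  · ext x
    rw [mem_cellMatrices_iff hh w hlam hc]
    constructor
    · rintro ⟨v, rfl⟩
      exact heval v
    · rintro ⟨Y, H⟩
      refine ⟨fun e => x e.1.2 e.1.1, ?_⟩
      obtain ⟨Y', H'⟩ := heval fun e => x e.1.2 e.1.1
      refine H'.eq_of_edge hd H fun i j e => ?_
      change MvPolynomial.eval _ (X i j) = x i j
      rw [hedge ⟨(j, i), e⟩, MvPolynomial.eval_X]
  · intro X' hX'
    ext1 i j
    refine MvPolynomial.funext fun v => ?_
    have hmem : X'.map (MvPolynomial.eval v) ∈ cellMatrices lam c h w := by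
      rw [← hX'.range_eq]
      exact ⟨v, rfl⟩
    obtain ⟨Y', H'⟩ := (mem_cellMatrices_iff hh w hlam hc).1 hmem
    obtain ⟨Y, H⟩ := heval v
    have := H'.eq_of_edge hd H fun i j e => by
      rw [Matrix.map_apply, Matrix.map_apply, hedge ⟨(j, i), e⟩, hX'.free ⟨(j, i), e⟩]
    exact congrFun (congrFun this i) j

/-! ### Residues and colliding eigenvalues -/

section

variable {R : Type*} [CommRing R] [Algebra ℂ R] {w : Equiv.Perm (Fin n)} {h : Fin n → Fin n}

/-- The sum in the recursion for the entry `(a, b)` of `eigenRow`. It equals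
`(d a - d b) x_{a,b}` if `b < a` and `d a ≠ d b`, but involves only the entries `x_{a,k}` with
`k > b`, so it does not become singular when `d a` and `d b` collide; there it is, up to a constant,
the residue of `x_{a,b}`. -/
noncomputable def eigenResidue (d : Fin n → ℂ) (Y : Matrix (Fin n) (Fin n) R) (a b : Fin n) : R :=
  ∑ k : Fin n, if b < k then eigenRow d Y a k * Y k b else 0

theorem map_eigenResidue {R' : Type*} [CommRing R'] [Algebra ℂ R'] (f : R →ₐ[ℂ] R')
    (d : Fin n → ℂ) (Y : Matrix (Fin n) (Fin n) R) (a b : Fin n) :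
    f (eigenResidue d Y a b) = eigenResidue d (Y.map f) a b := by
  rw [eigenResidue, eigenResidue, map_sum]
  refine Finset.sum_congr rfl fun k _ => ?_
  split_ifs
  · rw [map_mul, map_eigenRow, Matrix.map_apply]
  · exact map_zero f

/-- Column `b` of `Y` does not enter the entries `x_{a,k}` with `k > b`, so it can be chosen to
pick out one of them. -/
theorem exists_eigenResidue_ne_zero_of_edge {d : Fin n → ℂ} {a b m : Fin n} (e : Edge w h b m)
    {Y : Matrix (Fin n) (Fin n) ℂ} (hY : ∀ i j, ¬ Edge w h j i → Y i j = 0)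
    (hm : eigenRow d Y a m ≠ 0) :
    ∃ Y' : Matrix (Fin n) (Fin n) ℂ, (∀ i j, ¬ Edge w h j i → Y' i j = 0) ∧
      eigenResidue d Y' a b ≠ 0 := by
  classical
  let Y' : Matrix (Fin n) (Fin n) ℂ :=
    Matrix.of fun i j => if j = b then (if i = m then 1 else 0) else Y i j
  refine ⟨Y', fun i j hE => ?_, ?_⟩
  · by_cases hj : j = b
    · have hi : i ≠ m := by
        rintro rfl
        exact hE (hj ▸ e)
      simp [Y', hj, hi]
    · simp [Y', hj, hY i j hE]
  · have hcongr : eigenRow d Y' a m = eigenRow d Y a m :=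
      eigenRow_congr a m fun i l hl => by simp [Y', (e.lt.trans_le hl).ne']
    rw [eigenResidue, Finset.sum_eq_single m]
    · simpa [e.lt, Y', hcongr] using hm
    · intro k _ hk
      simp [Y', hk]
    · simp

theorem exists_eigenRow_ne_zero {d : Fin n → ℂ} {a b : Fin n} (hr : Reachable w h b a)
    (hd : ∀ k, b ≤ k → k < a → d a ≠ d k) :
    ∃ Y : Matrix (Fin n) (Fin n) ℂ, (∀ i j, ¬ Edge w h j i → Y i j = 0) ∧
      eigenRow d Y a b ≠ 0 := by
  induction hr using Relation.ReflTransGen.head_induction_on with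
  | refl => exact ⟨0, fun _ _ _ => rfl, by simp [eigenRow_self]⟩
  | @head b m e hma ih =>
    obtain ⟨Y, hY, hm⟩ := ih fun k hk => hd k (e.lt.le.trans hk)
    obtain ⟨Y', hY', hres⟩ := exists_eigenResidue_ne_zero_of_edge e hY hm
    have hba : b < a := e.lt.trans_le (Reachable.le hma).1
    refine ⟨Y', hY', ?_⟩
    rw [eigenRow_of_gt _ _ hba]
    exact smul_ne_zero (inv_ne_zero (sub_ne_zero.2 (hd b le_rfl hba))) hres

theorem exists_eigenResidue_ne_zero {d : Fin n → ℂ} {a b : Fin n} (hr : Reachable w h b a)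
    (hab : a ≠ b) (hd : ∀ k, b < k → k < a → d a ≠ d k) :
    ∃ Y : Matrix (Fin n) (Fin n) ℂ, (∀ i j, ¬ Edge w h j i → Y i j = 0) ∧
      eigenResidue d Y a b ≠ 0 := by
  rcases Relation.ReflTransGen.cases_head hr with rfl | ⟨m, e, hma⟩
  · exact absurd rfl hab
  · obtain ⟨Y, hY, hm⟩ :=
      exists_eigenRow_ne_zero hma fun k hk => hd k (lt_of_lt_of_le e.lt hk)
    exact exists_eigenResidue_ne_zero_of_edge e hY hm

/-- A generic `Y` makes finitely many residues nonzero at the same time: as polynomials in the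
entries of `Y` they are nonzero, hence so is their product. -/
theorem exists_forall_eigenResidue_ne_zero {ι : Type*} (s : Finset ι) {d : Fin n → ℂ}
    (a b : ι → Fin n) (hr : ∀ e ∈ s, Reachable w h (b e) (a e)) (hab : ∀ e ∈ s, a e ≠ b e)
    (hd : ∀ e ∈ s, ∀ k, b e < k → k < a e → d (a e) ≠ d k) :
    ∃ Y : Matrix (Fin n) (Fin n) ℂ, (∀ i j, ¬ Edge w h j i → Y i j = 0) ∧
      ∀ e ∈ s, eigenResidue d Y (a e) (b e) ≠ 0 := by
  have hne : ∏ e ∈ s, eigenResidue d (edgeVariables w h) (a e) (b e) ≠ 0 := by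
    refine Finset.prod_ne_zero_iff.2 fun e he h0 => ?_
    obtain ⟨Y, hY, hres⟩ := exists_eigenResidue_ne_zero (hr e he) (hab e he) (hd e he)
    refine hres ?_
    rw [← map_edgeVariables hY, ← map_eigenResidue, h0, map_zero]
  obtain ⟨v, hv⟩ : ∃ v, MvPolynomial.aeval v
      (∏ e ∈ s, eigenResidue d (edgeVariables w h) (a e) (b e)) ≠ (0 : ℂ) := by
    by_contra! hcon
    exact hne (MvPolynomial.funext fun v => by simpa using hcon v)
  rw [map_prod] at hv
  refine ⟨(edgeVariables w h).map (MvPolynomial.aeval v), fun i j hE => ?_, fun e he => ?_⟩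
  · simp [edgeVariables, hE]
  · rw [← map_eigenResidue]
    exact Finset.prod_ne_zero_iff.1 hv e he

end

section Limit

variable {d₀ p : Fin n → ℂ} {Y : Matrix (Fin n) (Fin n) ℂ}

theorem tendsto_perturbed_sub (d₀ p : Fin n → ℂ) (i j : Fin n) :
    Tendsto (fun ε : ℂ => (d₀ i + ε * p i) - (d₀ j + ε * p j)) (𝓝[≠] 0) (𝓝 (d₀ i - d₀ j)) := by
  have : Continuous fun ε : ℂ => (d₀ i + ε * p i) - (d₀ j + ε * p j) := by fun_prop
  simpa using (this.tendsto 0).mono_left nhdsWithin_le_nhds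

theorem tendsto_eigenRow {a j : Fin n} (hd : ∀ k, j ≤ k → k < a → d₀ a ≠ d₀ k) :
    Tendsto (fun ε : ℂ => eigenRow (fun i => d₀ i + ε * p i) Y a j) (𝓝[≠] 0)
      (𝓝 (eigenRow d₀ Y a j)) := by
  induction j using fin_down_induction with
  | H j ih =>
    rcases lt_trichotomy a j with hj | rfl | hj
    · simp only [eigenRow_of_lt hj]
      exact tendsto_const_nhds
    · simp only [eigenRow_self]
      exact tendsto_const_nhds
    · simp only [eigenRow_of_gt _ _ hj]
      refine ((tendsto_perturbed_sub d₀ p a j).inv₀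
        (sub_ne_zero.2 (hd j le_rfl hj))).smul (tendsto_finsetSum _ fun k _ => ?_)
      split_ifs with hk
      · exact (ih k hk fun l hl => hd l (hk.le.trans hl)).mul_const _
      · exact tendsto_const_nhds

/-- If the eigenvalues `d a` and `d b` collide as `ε → 0`, then row `a` of `x`, multiplied by `ε`,
converges to a multiple of row `b`. The case `p a = p b` is not excluded: the limit is then `0`, as
`0⁻¹ = 0`. -/
theorem tendsto_mul_eigenRow {a b : Fin n} (hba : b < a) (hcol : d₀ a = d₀ b)
    (hd : ∀ k, k ≠ a → k ≠ b → d₀ a ≠ d₀ k) (j : Fin n) :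
    Tendsto (fun ε : ℂ => ε * eigenRow (fun i => d₀ i + ε * p i) Y a j) (𝓝[≠] 0)
      (𝓝 ((p a - p b)⁻¹ * eigenResidue d₀ Y a b * eigenRow d₀ Y b j)) := by
  induction j using fin_down_induction with
  | H j ih =>
    have hreg : ∀ k, b < k → Tendsto (fun ε : ℂ => eigenRow (fun i => d₀ i + ε * p i) Y a k)
        (𝓝[≠] 0) (𝓝 (eigenRow d₀ Y a k)) := fun k hk =>
      tendsto_eigenRow fun l hl hla => hd l hla.ne (hk.trans_le hl).ne'
    rcases lt_trichotomy b j with hj | rfl | hj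
    · have hε : Tendsto (fun ε : ℂ => ε) (𝓝[≠] 0) (𝓝 0) := tendsto_id.mono_left nhdsWithin_le_nhds
      have hlim := hε.mul (hreg j hj)
      rw [zero_mul] at hlim
      rwa [eigenRow_of_lt hj, mul_zero]
    · rw [eigenRow_self, mul_one]
      have : Tendsto (fun ε : ℂ => (p a - p b)⁻¹ *
          eigenResidue (fun i => d₀ i + ε * p i) Y a b) (𝓝[≠] 0)
          (𝓝 ((p a - p b)⁻¹ * eigenResidue d₀ Y a b)) := by
        refine tendsto_const_nhds.mul (tendsto_finsetSum _ fun k _ => ?_)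
        split_ifs with hk
        · exact (hreg k hk).mul_const _
        · exact tendsto_const_nhds
      refine this.congr' ?_
      filter_upwards [self_mem_nhdsWithin] with ε hε
      have hε0 : ε ≠ 0 := hε
      have hsub : d₀ a + ε * p a - (d₀ b + ε * p b) = ε * (p a - p b) := by
        rw [hcol]
        ring
      rw [eigenRow_of_gt _ _ hba, smul_eq_mul, hsub, mul_inv, ← mul_assoc, ← mul_assoc,
        mul_inv_cancel₀ hε0, one_mul]
      rfl
    · have hja : j < a := hj.trans hba
      have hlim : Tendsto (fun ε : ℂ => ((d₀ a + ε * p a) - (d₀ j + ε * p j))⁻¹ *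
          ∑ k : Fin n, if j < k then
            (ε * eigenRow (fun i => d₀ i + ε * p i) Y a k) * Y k j else 0) (𝓝[≠] 0)
          (𝓝 ((d₀ a - d₀ j)⁻¹ * ∑ k : Fin n, if j < k then
            ((p a - p b)⁻¹ * eigenResidue d₀ Y a b * eigenRow d₀ Y b k) * Y k j else 0)) := by
        refine ((tendsto_perturbed_sub d₀ p a j).inv₀
          (sub_ne_zero.2 (hd j hja.ne hj.ne))).mul (tendsto_finsetSum _ fun k _ => ?_)
        split_ifs with hk
        · exact (ih k hk).mul_const _
        · exact tendsto_const_nhds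
      convert hlim using 1
      · ext ε
        rw [eigenRow_of_gt _ _ hja, smul_eq_mul, mul_left_comm, Finset.mul_sum]
        simp only [mul_ite, mul_zero, mul_assoc]
      · rw [eigenRow_of_gt _ _ hj, smul_eq_mul, hcol, mul_left_comm, Finset.mul_sum]
        simp only [mul_ite, mul_zero, mul_assoc]

end Limit

/-! ### Nonvanishing of minors -/

section

variable {w : Equiv.Perm (Fin n)} {h : Fin n → Fin n}

/-- If `A` is reachable from `B`, then the matching can be chosen to fix the elements of `A ∩ B`:
paths `b' → b` and `b → a` with `b ∈ A ∩ B` are replaced by the path `b' → b → a` and the path of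
length zero at `b`. -/
theorem exists_matching_fixing_inter {α β : Fin k → Fin n} (hα : Function.Injective α)
    (hβ : Function.Injective β) (hr : ∀ e, Reachable w h (β e) (α e)) :
    ∃ σ : Equiv.Perm (Fin k), (∀ e, Reachable w h (β e) (α (σ e))) ∧
      ∀ e f, α (σ e) = β f → e = f := by
  classical
  -- A matching with the greatest number of fixed elements does it.
  let good : Finset (Equiv.Perm (Fin k)) :=
    Finset.univ.filter fun σ => ∀ e, Reachable w h (β e) (α (σ e))
  let fixedBy : Equiv.Perm (Fin k) → Finset (Fin k) := fun σ =>
    Finset.univ.filter fun e => α (σ e) = β e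
  obtain ⟨σ, hσ, hmax⟩ := Finset.exists_max_image good (fun σ => (fixedBy σ).card)
    ⟨1, by simpa [good] using hr⟩
  have hσr : ∀ e, Reachable w h (β e) (α (σ e)) := by simpa [good] using hσ
  refine ⟨σ, hσr, fun e f hef => ?_⟩
  by_contra hne
  have hnf : α (σ f) ≠ β f := fun hf => hne (σ.injective (hα (hef.trans hf.symm)))
  have hne' : α (σ e) ≠ β e := fun he => hne (hβ (he.symm.trans hef))
  let τ : Equiv.Perm (Fin k) := σ * Equiv.swap e f
  have hτe : τ e = σ f := by simp [τ]
  have hτf : τ f = σ e := by simp [τ]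
  have hτ : ∀ x, x ≠ e → x ≠ f → τ x = σ x := fun x hxe hxf => by
    simp [τ, Equiv.swap_apply_of_ne_of_ne hxe hxf]
  have hgood : τ ∈ good := by
    refine Finset.mem_filter.2 ⟨Finset.mem_univ _, fun x => ?_⟩
    by_cases hxe : x = e
    · rw [hxe, hτe]
      have h1 := hσr e
      rw [hef] at h1
      exact Relation.ReflTransGen.trans h1 (hσr f)
    · by_cases hxf : x = f
      · rw [hxf, hτf, hef]
        exact Relation.ReflTransGen.refl
      · rw [hτ x hxe hxf]
        exact hσr x
  have hlt : (fixedBy σ).card < (fixedBy τ).card := by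
    refine Finset.card_lt_card ((Finset.ssubset_iff_of_subset fun x hx => ?_).2
      ⟨f, by simp [fixedBy, hτf, hef], by simp [fixedBy, hnf]⟩)
    have hx' : α (σ x) = β x := by simpa [fixedBy] using hx
    have hxe : x ≠ e := by
      rintro rfl
      exact hne' hx'
    have hxf : x ≠ f := by
      rintro rfl
      exact hnf hx'
    simpa [fixedBy, hτ x hxe hxf] using hx'
  exact absurd (hmax τ hgood) (not_le.2 hlt)

/-- The eigenvalues of matched vertices are brought together; in the limit the rows `α e` become
multiples of the rows `β e`. -/
theorem exists_det_eigenRow_ne_zero {α β : Fin k → Fin n} (hα : Function.Injective α)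
    (hβ : StrictMono β) (hr : ∀ e, Reachable w h (β e) (α e))
    (hfix : ∀ e f, α e = β f → e = f) :
    ∃ d : Fin n → ℂ, Function.Injective d ∧ ∃ Y : Matrix (Fin n) (Fin n) ℂ,
      (∀ i j, ¬ Edge w h j i → Y i j = 0) ∧
        ((Matrix.of (eigenRow d Y)).submatrix α β).det ≠ 0 := by
  classical
  -- The eigenvalues are `d₀ i + ε i`, where `d₀` takes equal values exactly at matched vertices.
  let π : Fin n → Fin n := Function.extend α β id
  have hπα : ∀ e, π (α e) = β e := fun e => hα.extend_apply _ _ _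
  have hπ : ∀ i, (∀ e, α e ≠ i) → π i = i := fun i hi =>
    Function.extend_apply' _ _ _ fun ⟨e, he⟩ => hi e he
  let d₀ : Fin n → ℂ := fun i => ((π i : ℕ) : ℂ)
  let p : Fin n → ℂ := fun i => ((i : ℕ) : ℂ)
  have hcast : ∀ i j : Fin n, ((i : ℕ) : ℂ) = ((j : ℕ) : ℂ) → i = j := fun i j hij =>
    Fin.ext (Nat.cast_injective hij)
  have hsep : ∀ e i, i ≠ α e → i ≠ β e → d₀ (α e) ≠ d₀ i := by
    intro e i hiα hiβ heq
    have heq' : π (α e) = π i := hcast _ _ heq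
    rw [hπα] at heq'
    by_cases hi : ∃ f, α f = i
    · obtain ⟨f, rfl⟩ := hi
      rw [hπα] at heq'
      exact hiα (congrArg α (hβ.injective heq').symm)
    · rw [hπ i fun f hf => hi ⟨f, hf⟩] at heq'
      exact hiβ heq'.symm
  have hcol : ∀ e, d₀ (α e) = d₀ (β e) := by
    intro e
    by_cases hi : ∃ f, α f = β e
    · obtain ⟨f, hf⟩ := hi
      have := hfix f e hf
      subst this
      rw [hf]
    · simp only [d₀]
      rw [hπα, hπ (β e) fun f hf => hi ⟨f, hf⟩]
  let s : Finset (Fin k) := Finset.univ.filter fun e => α e ≠ β e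
  obtain ⟨Y, hY, hres⟩ := exists_forall_eigenResidue_ne_zero (w := w) (h := h) s (d := d₀) α β
    (fun e _ => hr e) (fun e he => by simpa [s] using he)
    (fun e _ i hi hi' => hsep e i hi'.ne hi.ne')
  let r : Fin k → ℂ := fun e =>
    if α e = β e then 1 else (p (α e) - p (β e))⁻¹ * eigenResidue d₀ Y (α e) (β e)
  have hr0 : ∀ e, r e ≠ 0 := by
    intro e
    by_cases he : α e = β e
    · simp [r, he]
    · simp only [r, he, if_false]
      exact mul_ne_zero (inv_ne_zero (sub_ne_zero.2 fun hh => he (hcast _ _ hh)))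
        (hres e (by simpa [s] using he))
  let scale : ℂ → Fin k → ℂ := fun ε e => if α e = β e then 1 else ε
  have hrow : ∀ e j, Tendsto (fun ε : ℂ => scale ε e *
      eigenRow (fun i => d₀ i + ε * p i) Y (α e) j) (𝓝[≠] 0)
      (𝓝 (r e * eigenRow d₀ Y (β e) j)) := by
    intro e j
    by_cases he : α e = β e
    · have := tendsto_eigenRow (d₀ := d₀) (p := p) (Y := Y) (a := α e) (j := j)
        fun i _ hi => hsep e i hi.ne (he ▸ hi.ne)
      simpa [scale, r, he] using this
    · simp only [scale, r, he, if_false]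
      exact tendsto_mul_eigenRow (lt_of_le_of_ne (Reachable.le (hr e)).1 (Ne.symm he))
        (hcol e) (hsep e) j
  -- The limit is, up to nonzero factors of the rows, a principal minor of a unitriangular matrix.
  have hdet : ((Matrix.of (eigenRow d₀ Y)).submatrix β β).det = 1 := by
    refine IsLowerUnitriangular.det_eq_one ⟨fun e => eigenRow_self _, fun e f hef => ?_⟩
    exact eigenRow_of_lt (hβ hef)
  have hlim : Tendsto (fun ε : ℂ => (∏ e, scale ε e) *
      ((Matrix.of (eigenRow (fun i => d₀ i + ε * p i) Y)).submatrix α β).det) (𝓝[≠] 0)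
      (𝓝 (∏ e, r e)) := by
    have h1 : Tendsto (fun ε : ℂ => Matrix.of fun e f => scale ε e *
        (Matrix.of (eigenRow (fun i => d₀ i + ε * p i) Y)).submatrix α β e f) (𝓝[≠] 0)
        (𝓝 (Matrix.of fun e f => r e * (Matrix.of (eigenRow d₀ Y)).submatrix β β e f)) :=
      tendsto_pi_nhds.2 fun e => tendsto_pi_nhds.2 fun f => hrow e (β f)
    have h2 := ((continuous_id.matrix_det).tendsto _).comp h1
    simp only [id, Matrix.det_mul_column, hdet, mul_one] at h2
    refine h2.congr fun ε => ?_
    rw [Function.comp_apply, Matrix.det_mul_column]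
  have hinj : ∀ᶠ ε : ℂ in 𝓝[≠] 0, ∀ i j : Fin n, i ≠ j →
      (d₀ i + ε * p i) - (d₀ j + ε * p j) ≠ 0 := by
    refine eventually_all.2 fun i => eventually_all.2 fun j => ?_
    by_cases hd : d₀ i = d₀ j
    · filter_upwards [self_mem_nhdsWithin] with ε hε hij
      have hsub : d₀ i + ε * p i - (d₀ j + ε * p j) = ε * (p i - p j) := by
        rw [hd]
        ring
      rw [hsub]
      exact mul_ne_zero hε (sub_ne_zero.2 fun hh => hij (hcast _ _ hh))
    · filter_upwards [(tendsto_perturbed_sub d₀ p i j).eventually_ne (sub_ne_zero.2 hd)]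
        with ε hε _ using hε
  obtain ⟨ε, hε, hne⟩ := (hinj.and (hlim.eventually_ne
    (Finset.prod_ne_zero_iff.2 fun e _ => hr0 e))).exists
  refine ⟨fun i => d₀ i + ε * p i, fun i j hij => ?_, Y, hY, right_ne_zero_of_mul hne⟩
  by_contra hne'
  exact hε i j hne' (sub_eq_zero.2 hij)

end

theorem map_minor {R R' : Type*} [CommRing R] [CommRing R'] (f : R →+* R') (A B : Finset (Fin n))
    (hA : A.card = k) (hB : B.card = k) (x : Matrix (Fin n) (Fin n) R) :
    f (minor A B hA hB x) = minor A B hA hB (x.map f) := by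
  rw [minor, minor, RingHom.map_det]
  rfl

theorem IsEigenPair.setReachable_of_minor_ne_zero {w : Equiv.Perm (Fin n)} {h : Fin n → Fin n}
    {d : Fin n → ℂ} {x Y : Matrix (Fin n) (Fin n) ℂ} (hd : Function.Injective d)
    (H : IsEigenPair w h d x Y) {A B : Finset (Fin n)} {hA : A.card = k} {hB : B.card = k}
    (hm : minor A B hA hB x ≠ 0) : SetReachable w h A B hA hB := by
  rw [minor, Matrix.det_apply] at hm
  obtain ⟨σ, -, hσ⟩ := Finset.exists_ne_zero_of_sum_ne_zero hm
  refine ⟨σ, fun e => H.reachable_of_ne_zero hd _ _ ?_⟩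
  exact Finset.prod_ne_zero_iff.1 (right_ne_zero_of_smul hσ) e (Finset.mem_univ e)

/-- For suitable eigenvalues, some solution of the eigenpair equation has a nonzero minor. -/
theorem exists_isEigenPair_minor_ne_zero {w : Equiv.Perm (Fin n)} {h : Fin n → Fin n}
    {A B : Finset (Fin n)} {hA : A.card = k} {hB : B.card = k}
    (hr : SetReachable w h A B hA hB) :
    ∃ d : Fin n → ℂ, Function.Injective d ∧ ∃ x Y : Matrix (Fin n) (Fin n) ℂ,
      IsEigenPair w h d x Y ∧ minor A B hA hB x ≠ 0 := by
  obtain ⟨σ, hσ⟩ := hr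
  obtain ⟨τ, hτr, hτfix⟩ := exists_matching_fixing_inter
    (α := fun e => A.orderEmbOfFin hA (σ e)) (β := B.orderEmbOfFin hB)
    ((A.orderEmbOfFin hA).injective.comp σ.injective) (B.orderEmbOfFin hB).injective hσ
  obtain ⟨d, hd, Y, hY, hdet⟩ := exists_det_eigenRow_ne_zero
    (α := fun e => A.orderEmbOfFin hA (σ (τ e)))
    ((A.orderEmbOfFin hA).injective.comp (σ.injective.comp τ.injective))
    (B.orderEmbOfFin hB).strictMono hτr hτfix
  refine ⟨d, hd, Matrix.of (eigenRow d Y), Y, isEigenPair_eigenRow hd hY, fun h0 => hdet ?_⟩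
  have := Matrix.det_permute (σ * τ) ((Matrix.of (eigenRow d Y)).submatrix
    (A.orderEmbOfFin hA) (B.orderEmbOfFin hB))
  rw [minor] at h0
  rw [h0, mul_zero] at this
  exact this

end HessCell

theorem theorem3p13 {n k : ℕ} (h : Fin n → Fin n) (hh : HessCell.IsHessenberg h)
    (w : Equiv.Perm (Fin n)) (A B : Finset (Fin n)) (hA : A.card = k) (hB : B.card = k) :
    ∃ c : Fin n → ℂ, Function.Injective c ∧ ∀ lam : Fin n → ℤ, StrictAnti lam →
      (∃! X : Matrix (Fin n) (Fin n) (HessCell.FreePoly w h),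
        HessCell.IsGeneralElement lam c h w X) ∧
      ∀ X : Matrix (Fin n) (Fin n) (HessCell.FreePoly w h),
        HessCell.IsGeneralElement lam c h w X →
          (HessCell.minor A B hA hB X ≠ 0 ↔ HessCell.SetReachable w h A B hA hB) := by
  obtain ⟨d, hd, hdr⟩ : ∃ d : Fin n → ℂ, Function.Injective d ∧
      (HessCell.SetReachable w h A B hA hB → ∃ x Y : Matrix (Fin n) (Fin n) ℂ,
        HessCell.IsEigenPair w h d x Y ∧ HessCell.minor A B hA hB x ≠ 0) := by
    by_cases hr : HessCell.SetReachable w h A B hA hB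
    · obtain ⟨d, hd, hx⟩ := HessCell.exists_isEigenPair_minor_ne_zero hr
      exact ⟨d, hd, fun _ => hx⟩
    · exact ⟨fun i => ((i : ℕ) : ℂ), fun i j hij => Fin.ext (Nat.cast_injective hij),
        fun hr' => absurd hr' hr⟩
  have hc : Function.Injective (d ∘ w.symm) := hd.comp w.symm.injective
  have hcw : (d ∘ w.symm) ∘ w = d := by
    ext i
    simp
  refine ⟨d ∘ w.symm, hc, fun lam hlam =>
    ⟨HessCell.existsUnique_isGeneralElement hh w hlam hc, fun X hX => ⟨fun hm => ?_, fun hr => ?_⟩⟩⟩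
  · obtain ⟨v, hv⟩ : ∃ v, MvPolynomial.eval v (HessCell.minor A B hA hB X) ≠ 0 := by
      by_contra! hcon
      exact hm (MvPolynomial.funext fun v => by rw [hcon v, map_zero])
    have hmem : X.map (MvPolynomial.eval v) ∈ HessCell.cellMatrices lam (d ∘ w.symm) h w := by
      rw [← hX.range_eq]
      exact ⟨v, rfl⟩
    obtain ⟨Y, H⟩ := (HessCell.mem_cellMatrices_iff hh w hlam hc).1 hmem
    rw [HessCell.map_minor] at hv
    exact H.setReachable_of_minor_ne_zero (hc.comp w.injective) hv
  · obtain ⟨x, Y, H, hx⟩ := hdr hr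
    have hmem : x ∈ HessCell.cellMatrices lam (d ∘ w.symm) h w :=
      (HessCell.mem_cellMatrices_iff hh w hlam hc).2 ⟨Y, by rwa [hcw]⟩
    rw [← hX.range_eq] at hmem
    obtain ⟨v, rfl⟩ := hmem
    rintro h0
    refine hx ?_
    change HessCell.minor A B hA hB (X.map (MvPolynomial.eval v)) = 0
    rw [← HessCell.map_minor, h0, map_zero]
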